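/- For an $r$-tuple $(\alpha_1,\dots,\alpha_r)$ of positive integers with $\alpha_r\ge 2$, let $$\zeta^\star(\alpha_1,\dots,\alpha_r)=\sum_{1\le k_1\le k_2\le\cdots\le k_r} k_1^{-\alpha_1}k_2^{-\alpha_2}\cdots k_r^{-\alpha_r}$$ (a convergent series of positive terms), let $\{1\}^m$ denote $m$ repetitions of $1$, and let $\zeta$ be the Riemann zeta function. For all integers $m\ge 0$ and $n\ge 2$, $$\sum_{\substack{\alpha_1+\alpha_2=n\\ \alpha_1,\alpha_2\ge 1}}\zeta^\star(\alpha_1,\{1\}^m,\alpha_2+1)=(m+n)\,\zeta(m+n+1).$$ -/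

import Mathlib

/-- The term `k₁^{-α₁} ⋯ k_r^{-α_r}` of a multiple zeta(-star) series with exponents
`α = (α₁, …, α_r)`, at a tuple `k = (k₁, …, k_r)` of positive integers. -/
noncomputable def multipleZetaTerm (α : List ℕ) (k : Fin α.length → ℕ+) : ℝ :=
  ∏ i, (((k i : ℕ) : ℝ) ^ α.get i)⁻¹

/-- The index set `1 ≤ k₁ ≤ k₂ ≤ ⋯ ≤ k_r` of the multiple zeta-star series of depth `r`. -/
abbrev ZetaStarIndex (r : ℕ) : Type := {k : Fin r → ℕ+ // Monotone k}

/-- Convergence of the series defining the multiple zeta-star value `ζ⋆(α₁, …, α_r)`. -/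
def ZetaStarSummable (α : List ℕ) : Prop :=
  Summable fun k : ZetaStarIndex α.length => multipleZetaTerm α k.1

/-- The multiple zeta-star value
`ζ⋆(α₁, …, α_r) = ∑_{1 ≤ k₁ ≤ ⋯ ≤ k_r} k₁^{-α₁} ⋯ k_r^{-α_r}`. -/
noncomputable def multipleZetaStar (α : List ℕ) : ℝ :=
  ∑' k : ZetaStarIndex α.length, multipleZetaTerm α k.1

/-! Write `h(k, l)` for the harmonic-star sum of the `m` middle variables between `k` and `l`, and
put `N = n - 1`. Each star value is `∑_{k ≤ l} k^{-a} h(k, l) l^{-b}`. Summing over the exponents is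
a geometric sum (`sum_inv_pow_mul_inv_pow`): for `k < l` it gives `h(k, l) (k^{-N} - l^{-N}) / (l (l
- k))`, while each diagonal pair gives `N / k^{m + N + 2}`.

It remains to compare, for fixed `p`, the sum of `h(p, l) / (l (l - p))` over `l > p` with the sum
of `h(k, p) / (p (p - k))` over `k < p`. Both satisfy the same recursion in `m`, driven by power
sums up to `p` and up to `p - 1` respectively (`hasSum_multiHarmonic`, `sum_multiHarmonic_div_sub`).
Hence they differ by exactly `(m + 1) / p^{m + 2}` (`hasSum_upperSum`). Weighting by `p^{-N}` and
summing gives `(N + m + 1) ζ(m + N + 2)`. -/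

open Finset Filter Topology

open scoped ENNReal

/-! ### Truncated harmonic-star sums and their recursions -/

/-- The truncated multiple harmonic-star sum `∑_{k ≤ k₁ ≤ ⋯ ≤ k_m ≤ l} (k₁ ⋯ k_m)⁻¹`. -/
noncomputable def multiHarmonic : ℕ → ℕ → ℕ → ℝ
  | 0, _, _ => 1
  | m + 1, k, l => ∑ j ∈ Icc k l, multiHarmonic m k j / j

theorem multiHarmonic_zero (k l : ℕ) : multiHarmonic 0 k l = 1 := rfl

theorem multiHarmonic_nonneg (m k l : ℕ) : 0 ≤ multiHarmonic m k l := by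
  induction m generalizing l with
  | zero => simp [multiHarmonic]
  | succ m ih => exact sum_nonneg fun j _ => div_nonneg (ih j) j.cast_nonneg

theorem multiHarmonic_succ_of_lt {k l : ℕ} (m : ℕ) (h : l < k) :
    multiHarmonic (m + 1) k l = 0 := by
  simp [multiHarmonic, Icc_eq_empty_of_lt h]

theorem multiHarmonic_self (m k : ℕ) : multiHarmonic m k k = ((k : ℝ) ^ m)⁻¹ := by
  induction m with
  | zero => simp [multiHarmonic]
  | succ m ih => simp [multiHarmonic, ih, pow_succ, div_eq_mul_inv, mul_comm]

theorem multiHarmonic_succ_right {k l : ℕ} (m : ℕ) (h : k ≤ l + 1) :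
    multiHarmonic (m + 1) k (l + 1) =
      multiHarmonic (m + 1) k l + multiHarmonic m k (l + 1) / ((l : ℝ) + 1) := by
  rw [multiHarmonic, sum_Icc_succ_top h]
  push_cast
  rfl

/-- The definition peels off the largest variable; this peels off the smallest, which either equals
`k` or is at least `k + 1`. -/
theorem multiHarmonic_succ_left {k l : ℕ} (m : ℕ) (h : k ≤ l) :
    multiHarmonic (m + 1) k l =
      multiHarmonic (m + 1) (k + 1) l + multiHarmonic m k l / k := by
  have hI : Ioc k l = Icc (k + 1) l := by
    ext j
    simp
  induction m generalizing l with
  | zero =>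
    simp only [multiHarmonic]
    rw [← add_sum_Ioc_eq_sum_Icc h, add_comm, hI]
  | succ m ih =>
    rw [multiHarmonic.eq_2 k l (m + 1), ← add_sum_Ioc_eq_sum_Icc h, multiHarmonic_self,
      multiHarmonic.eq_2 k l m, multiHarmonic.eq_2 (k + 1) l (m + 1),
      ← add_sum_Ioc_eq_sum_Icc h, multiHarmonic_self]
    have : ∀ j ∈ Ioc k l, multiHarmonic (m + 1) k j / (j : ℝ) =
        multiHarmonic (m + 1) (k + 1) j / j + multiHarmonic m k j / j / k := fun j hj => by
      rw [ih (mem_Ioc.1 hj).1.le (by ext; simp)]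
      ring
    rw [sum_congr rfl this, sum_add_distrib, add_div, sum_div,
      hI, pow_succ]
    ring

theorem multiHarmonic_succ_eq_sum_left (m k i : ℕ) :
    multiHarmonic (m + 1) k (k + i) =
      ∑ j ∈ range (i + 1), multiHarmonic m (k + j) (k + i) / ((k + j : ℕ) : ℝ) := by
  have h : ∀ j ∈ range (i + 1), multiHarmonic m (k + j) (k + i) / ((k + j : ℕ) : ℝ) =
      multiHarmonic (m + 1) (k + j) (k + i) - multiHarmonic (m + 1) (k + (j + 1)) (k + i) :=
    fun j hj => by
      rw [multiHarmonic_succ_left m (k := k + j) (l := k + i)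
        (by have := mem_range.1 hj; omega), ← add_assoc k j 1]
      ring
  rw [sum_congr rfl h, sum_range_sub' (fun j => multiHarmonic (m + 1) (k + j) (k + i)),
    multiHarmonic_succ_of_lt m (by omega : k + i < k + (i + 1))]
  simp

/-- Dropping the ordering of the variables leaves a product of `m` harmonic sums. The resulting
logarithmic growth kills the boundary term of the telescoping below. -/
theorem multiHarmonic_le_harmonic_pow {k : ℕ} (hk : 1 ≤ k) (m l : ℕ) :
    multiHarmonic m k l ≤ (harmonic l : ℝ) ^ m := by
  have hmono : Monotone fun n : ℕ => (harmonic n : ℝ) := monotone_nat_of_le_succ fun n => by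
    rw [harmonic_succ]
    push_cast
    have : (0 : ℝ) ≤ ((n : ℝ) + 1)⁻¹ := by positivity
    linarith
  have h0 : ∀ n : ℕ, (0 : ℝ) ≤ harmonic n := fun n => by simpa using hmono n.zero_le
  induction m generalizing l with
  | zero => simp [multiHarmonic]
  | succ m ih =>
    have hl : (harmonic l : ℝ) ^ (m + 1) =
        ∑ j ∈ Icc 1 l, (harmonic l : ℝ) ^ m * ((j : ℝ))⁻¹ := by
      rw [pow_succ, ← mul_sum, harmonic_eq_sum_Icc]
      push_cast
      rfl
    rw [multiHarmonic, hl]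
    refine (sum_le_sum fun j hj => ?_).trans
      (sum_le_sum_of_subset_of_nonneg (Icc_subset_Icc_left hk) fun j _ _ => ?_)
    · rw [div_eq_mul_inv]
      gcongr
      exact (ih j).trans (pow_le_pow_left₀ (h0 j) (hmono (mem_Icc.1 hj).2) m)
    · have := h0 l
      positivity

theorem tendsto_multiHarmonic_div {k : ℕ} (hk : 1 ≤ k) (m : ℕ) :
    Tendsto (fun l : ℕ => multiHarmonic m k l / (l : ℝ)) atTop (𝓝 0) := by
  have h : Tendsto (fun l : ℕ => (1 + Real.log l) ^ m / (l : ℝ)) atTop (𝓝 0) := by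
    have h1 : (fun x : ℝ => (1 + Real.log x) ^ m) =o[atTop] (id : ℝ → ℝ) := by
      have h2 : (fun x : ℝ => (1 + Real.log x) ^ m) =O[atTop] fun x => Real.log x ^ m := by
        refine Asymptotics.IsBigO.pow (Asymptotics.IsBigO.add ?_ (Asymptotics.isBigO_refl _ _)) m
        exact (Real.isLittleO_const_log_atTop (c := 1)).isBigO
      exact h2.trans_isLittleO Real.isLittleO_pow_log_id_atTop
    exact h1.tendsto_div_nhds_zero.comp tendsto_natCast_atTop_atTop
  refine squeeze_zero (fun l => div_nonneg (multiHarmonic_nonneg _ _ _) l.cast_nonneg)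
    (fun l => ?_) h
  have h0 : (0 : ℝ) ≤ harmonic l := by
    rcases l.eq_zero_or_pos with rfl | hl
    · simp
    · exact_mod_cast (harmonic_pos hl.ne').le
  gcongr
  exact (multiHarmonic_le_harmonic_pow hk m l).trans
    (pow_le_pow_left₀ h0 (harmonic_le_one_add_log l) m)

/-! ### Two weighted sums that collapse to power sums -/

/-- A finite form of the step `p → p + 1`, keeping the boundary term that vanishes as `n → ∞`.
Peeling at both ends expresses all increments in `n` through the values at `(p + 1, p + n + 2)`. -/
theorem sum_range_multiHarmonic_succ (m p n : ℕ) :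
    ∑ i ∈ range n, ((p + 1 : ℕ) : ℝ) / ((i + 1) * (p + i + 2)) *
        multiHarmonic m (p + 2) (p + i + 2) =
      ∑ i ∈ range n, (p : ℝ) / ((i + 1) * (p + i + 1)) * multiHarmonic m (p + 1) (p + i + 1) +
        (((p + 1 : ℕ) : ℝ) ^ (m + 1))⁻¹ -
        multiHarmonic m (p + 1) (p + n + 1) / ((p + n + 1 : ℕ) : ℝ) := by
  induction n with
  | zero => simp [multiHarmonic_self, pow_succ, div_eq_mul_inv]; ring
  | succ n ih =>
    rw [sum_range_succ, ih, sum_range_succ]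
    have h1 : ((n : ℝ) + 1) ≠ 0 := by positivity
    have h2 : ((p : ℝ) + 1) ≠ 0 := by positivity
    have h3 : ((p : ℝ) + n + 1) ≠ 0 := by positivity
    have h4 : ((p : ℝ) + n + 2) ≠ 0 := by positivity
    have h5 : ((p : ℝ) + (n + 1) + 1) ≠ 0 := by positivity
    rw [show p + (n + 1) + 1 = p + n + 2 by ring]
    cases m with
    | zero =>
      simp only [multiHarmonic_zero]
      push_cast
      field_simp
      ring
    | succ m =>
      have e1 := multiHarmonic_succ_left m (k := p + 1) (l := p + n + 2) (by omega)
      have e2 := multiHarmonic_succ_right m (k := p + 1) (l := p + n + 1) (by omega)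
      rw [show p + n + 1 + 1 = p + n + 2 by ring] at e2
      rw [← sub_eq_iff_eq_add] at e1 e2
      rw [show p + 2 = p + 1 + 1 by ring, ← e1, ← e2]
      push_cast
      have h6 : ((p : ℝ) + n + 1 + 1) ≠ 0 := by positivity
      field_simp
      ring

theorem hasSum_multiHarmonic (m p : ℕ) :
    HasSum (fun i : ℕ => (p : ℝ) / ((i + 1) * (p + i + 1)) *
      multiHarmonic m (p + 1) (p + i + 1)) (∑ j ∈ range p, (((j + 1 : ℕ) : ℝ) ^ (m + 1))⁻¹) := by
  have hnn : ∀ p i : ℕ, 0 ≤ (p : ℝ) / ((i + 1) * (p + i + 1)) *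
      multiHarmonic m (p + 1) (p + i + 1) := fun p i =>
    mul_nonneg (by positivity) (multiHarmonic_nonneg _ _ _)
  rw [hasSum_iff_tendsto_nat_of_nonneg (hnn p)]
  induction p with
  | zero => simp
  | succ p ih =>
    have hG : Tendsto (fun n : ℕ => multiHarmonic m (p + 1) (p + n + 1) / ((p + n + 1 : ℕ) : ℝ))
        atTop (𝓝 0) := by
      have := (tendsto_add_atTop_iff_nat (p + 1)).2
        (tendsto_multiHarmonic_div (Nat.le_add_left 1 p) m)
      refine this.congr fun n => ?_
      rw [show n + (p + 1) = p + n + 1 by ring]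
    have h := (ih.add_const (((p + 1 : ℕ) : ℝ) ^ (m + 1))⁻¹).sub hG
    rw [sum_range_succ]
    rw [sub_zero] at h
    refine h.congr fun n => ?_
    rw [← sum_range_multiHarmonic_succ]
    refine sum_congr rfl fun i _ => ?_
    rw [show p + 1 + i + 1 = p + i + 2 by ring]
    push_cast
    ring

/-- The finite counterpart of `hasSum_multiHarmonic`. From `q` to `q + 1`, the shift `k → k + 1`
preserves the denominator and the correction telescopes in `k`; its lower end cancels the new `k =
0` term and its upper end is the new power. -/
theorem sum_multiHarmonic_div_sub (m q : ℕ) :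
    ∑ k ∈ range q, multiHarmonic m (k + 1) q / ((q : ℝ) - k) =
      ∑ j ∈ range q, (((j + 1 : ℕ) : ℝ) ^ (m + 1))⁻¹ := by
  induction q with
  | zero => simp
  | succ q ih =>
    have hq : ((q : ℝ) + 1) ≠ 0 := by positivity
    have key : ∀ k ∈ range q, multiHarmonic m (k + 1 + 1) (q + 1) /
        (((q + 1 : ℕ) : ℝ) - ((k + 1 : ℕ) : ℝ)) = multiHarmonic m (k + 1) q / ((q : ℝ) - k) -
          (multiHarmonic m (k + 1) (q + 1) - multiHarmonic m (k + 1 + 1) (q + 1)) / (q + 1) := by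
      intro k hk
      have hk := mem_range.1 hk
      have h1 : ((q : ℝ) - k) ≠ 0 := sub_ne_zero.2 (by exact_mod_cast hk.ne')
      have h2 : ((k : ℝ) + 1) ≠ 0 := by positivity
      rw [show (((q + 1 : ℕ) : ℝ) - ((k + 1 : ℕ) : ℝ)) = q - k by push_cast; ring]
      cases m with
      | zero => simp [multiHarmonic_zero]
      | succ m =>
        have e1 := multiHarmonic_succ_left m (k := k + 1) (l := q + 1) (by omega)
        have e2 := multiHarmonic_succ_right m (k := k + 1) (l := q) (by omega)
        rw [← sub_eq_iff_eq_add] at e1 e2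
        rw [← e1, ← e2]
        push_cast
        field_simp
        ring
    rw [sum_range_succ', sum_congr rfl key, sum_sub_distrib, ih, ← sum_div,
      sum_range_sub' (fun k => multiHarmonic m (k + 1) (q + 1)), sum_range_succ,
      multiHarmonic_self, pow_succ]
    push_cast
    field_simp
    simp
    ring

/-! ### Comparison of the upper and lower weighted sums -/

/-- The weighted sum `∑_{k ≤ q} h(k, q + 1) / ((q + 1)(q + 1 - k))` over the smaller variable. -/
noncomputable def lowerSum (m q : ℕ) : ℝ :=
  ∑ k ∈ range q, multiHarmonic m (k + 1) (q + 1) / (((q : ℝ) + 1) * (q - k))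

theorem lowerSum_zero_left (q : ℕ) :
    lowerSum 0 q = (∑ j ∈ range q, (((j + 1 : ℕ) : ℝ) ^ 1)⁻¹) / (q + 1) := by
  rw [← sum_multiHarmonic_div_sub 0 q, lowerSum, sum_div]
  refine sum_congr rfl fun k _ => ?_
  rw [multiHarmonic_zero, multiHarmonic_zero, div_div, mul_comm]

theorem lowerSum_succ (m q : ℕ) :
    lowerSum (m + 1) q =
      (∑ j ∈ range q, (((j + 1 : ℕ) : ℝ) ^ (m + 2))⁻¹) / (q + 1) + lowerSum m q / (q + 1) := by
  rw [← sum_multiHarmonic_div_sub (m + 1) q, lowerSum, lowerSum, sum_div, sum_div,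
    ← sum_add_distrib]
  refine sum_congr rfl fun k hk => ?_
  have hk := mem_range.1 hk
  have h1 : ((q : ℝ) - k) ≠ 0 := sub_ne_zero.2 (by exact_mod_cast hk.ne')
  rw [multiHarmonic_succ_right m (by omega)]
  field_simp

theorem lowerSum_nonneg (m q : ℕ) : 0 ≤ lowerSum m q := by
  refine sum_nonneg fun k hk => div_nonneg (multiHarmonic_nonneg _ _ _) ?_
  have : (k : ℝ) ≤ q := by exact_mod_cast (mem_range.1 hk).le
  have := sub_nonneg.2 this
  positivity

theorem lowerSum_le (m q : ℕ) : lowerSum m q ≤ (m + 1) * ((harmonic q : ℝ) / (q + 1)) := by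
  have hs : ∀ m : ℕ, ∑ j ∈ range q, (((j + 1 : ℕ) : ℝ) ^ (m + 1))⁻¹ ≤ harmonic q := fun m => by
    rw [harmonic]
    push_cast
    refine sum_le_sum fun j _ => inv_anti₀ (by positivity) ?_
    exact le_self_pow₀ (by linarith [(j.cast_nonneg : (0 : ℝ) ≤ j)]) (by omega)
  induction m with
  | zero =>
    rw [lowerSum_zero_left]
    simp only [Nat.cast_zero, zero_add, one_mul]
    gcongr
    exact hs 0
  | succ m ih =>
    have h1 : lowerSum m q / (q + 1) ≤ lowerSum m q :=
      div_le_self (lowerSum_nonneg m q) (by linarith [(q.cast_nonneg : (0 : ℝ) ≤ q)])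
    have h2 := div_le_div_of_nonneg_right (hs (m + 1))
      (by positivity : (0 : ℝ) ≤ (q : ℝ) + 1)
    rw [lowerSum_succ]
    push_cast at h2 ⊢
    rw [show m + 1 + 1 = m + 2 from rfl] at h2
    linarith

/-- Exchanging the roles of the two variables in the weight `h(k, l) / (l (l - k))` produces
only the diagonal term `(m + 1) / p ^ (m + 2)`. -/
theorem hasSum_upperSum (m q : ℕ) :
    HasSum (fun i : ℕ => multiHarmonic m (q + 1) (q + i + 2) / (((q : ℝ) + i + 2) * (i + 1)))
      (lowerSum m q + ((m : ℝ) + 1) * (((q : ℝ) + 1) ^ (m + 2))⁻¹) := by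
  have hq : ((q : ℝ) + 1) ≠ 0 := by positivity
  have h := fun m => (hasSum_multiHarmonic m (q + 1)).div_const ((q : ℝ) + 1)
  have hc : ∀ {f g : ℕ → ℝ} {a b : ℝ}, HasSum f a → (∀ i, g i = f i) → b = a → HasSum g b :=
    fun h hf ha => by rwa [ha, funext hf]
  induction m with
  | zero =>
    refine hc (h 0) (fun i => ?_) ?_
    · rw [multiHarmonic_zero, multiHarmonic_zero]
      push_cast
      rw [show (q : ℝ) + 1 + i + 1 = q + i + 2 by ring]
      field_simp
    · rw [lowerSum_zero_left, sum_range_succ]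
      push_cast
      field_simp
      simp
  | succ m ih =>
    -- This is the recursion of `lowerSum_succ`, except that the power sum has one more term, `(q +
    -- 1)^{-(m + 2)}`. The excess therefore grows by one multiple of the diagonal term at each step
    -- in `m`.
    refine hc ((h (m + 1)).add (ih.div_const ((q : ℝ) + 1))) (fun i => ?_) ?_
    · rw [multiHarmonic_succ_left m (by omega), show q + 1 + i + 1 = q + i + 2 by ring]
      push_cast
      rw [show (q : ℝ) + 1 + i + 1 = q + i + 2 by ring]
      field_simp
    · rw [lowerSum_succ, sum_range_succ]
      push_cast
      field_simp
      ring

/-! ### Star series as iterated sums in `[0, ∞]` -/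

/-- The iterated series `∑_{c ≤ k₁ ≤ ⋯ ≤ k_r} k₁^{-α₁} ⋯ k_r^{-α_r}` with values in `[0, ∞]`. -/
noncomputable def iteratedZetaStar : List ℕ → ℕ → ℝ≥0∞
  | [], _ => 1
  | a :: s, c => ∑' i : ℕ, ENNReal.ofReal (((c + i : ℕ) : ℝ) ^ a)⁻¹ * iteratedZetaStar s (c + i)

theorem multipleZetaTerm_nonneg (α : List ℕ) (k : Fin α.length → ℕ+) :
    0 ≤ multipleZetaTerm α k :=
  prod_nonneg fun _ _ => by positivity

theorem multipleZetaTerm_cons (a : ℕ) (s : List ℕ) (x : ℕ+) (t : Fin s.length → ℕ+) :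
    multipleZetaTerm (a :: s) (Fin.cons x t : Fin (s.length + 1) → ℕ+) =
      (((x : ℕ) : ℝ) ^ a)⁻¹ * multipleZetaTerm s t := by
  unfold multipleZetaTerm
  exact Fin.prod_univ_succ (n := s.length) _

theorem Fin.monotone_cons {β : Type*} [Preorder β] {r : ℕ} {x : β} {t : Fin r → β}
    (ht : Monotone t) (h : ∀ j, x ≤ t j) : Monotone (Fin.cons x t : Fin (r + 1) → β) := by
  intro i j
  refine Fin.cases (fun _ => ?_) (fun i hij => ?_) i
  · refine Fin.cases ?_ (fun j => ?_) j
    · simp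
    · simpa using h j
  · revert hij
    refine Fin.cases (fun hij => ?_) (fun j hij => ?_) j
    · exact absurd hij (by simp)
    · simpa using ht (Fin.succ_le_succ_iff.1 hij)

/-- Splitting off the first entry `c + i` leaves a monotone tail bounded below by `c + i`, so the
induction needs an arbitrary lower bound `c`. -/
theorem tsum_multipleZetaTerm (α : List ℕ) {c : ℕ} (hc : 1 ≤ c) :
    ∑' k : {k : Fin α.length → ℕ+ // Monotone k ∧ ∀ i, c ≤ (k i : ℕ)},
      ENNReal.ofReal (multipleZetaTerm α k.1) = iteratedZetaStar α c := by
  induction α generalizing c with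
  | nil =>
    let e : {k : Fin ([] : List ℕ).length → ℕ+ // Monotone k ∧ ∀ i, c ≤ (k i : ℕ)} :=
      ⟨Fin.elim0, fun i => i.elim0, fun i => i.elim0⟩
    rw [tsum_eq_single e fun k hk => (hk (Subtype.ext (funext fun i => i.elim0))).elim]
    simp [multipleZetaTerm, iteratedZetaStar]
  | cons a s ih =>
    let F : (Σ i : ℕ, {k : Fin s.length → ℕ+ // Monotone k ∧ ∀ j, c + i ≤ (k j : ℕ)}) →
        {k : Fin (s.length + 1) → ℕ+ // Monotone k ∧ ∀ j, c ≤ (k j : ℕ)} := fun x =>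
      ⟨Fin.cons (Nat.toPNat (c + x.1) (by omega)) x.2.1,
        Fin.monotone_cons x.2.2.1 fun j => x.2.2.2 j,
        Fin.cases (Nat.le_add_right c x.1) fun j => (Nat.le_add_right c x.1).trans (x.2.2.2 j)⟩
    have hF : Function.Bijective F := by
      constructor
      · rintro ⟨i, t, ht⟩ ⟨j, u, hu⟩ h
        have h := Fin.cons_injective2 (α := fun _ : Fin (s.length + 1) => ℕ+)
          (congrArg Subtype.val h)
        have h1 : c + i = c + j := congrArg PNat.val h.1
        obtain rfl : i = j := by omega
        obtain rfl : t = u := h.2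
        rfl
      · rintro ⟨k, hk, hck⟩
        have h0 := hck 0
        refine ⟨⟨(k 0 : ℕ) - c, Fin.tail k, fun i j hij => hk (Fin.succ_le_succ_iff.2 hij),
          fun j => ?_⟩, Subtype.ext ?_⟩
        · have : (k 0 : ℕ) ≤ k j.succ := hk (Fin.zero_le _)
          simp only [Fin.tail]
          omega
        · refine Eq.trans ?_ (Fin.cons_self_tail k)
          have : Nat.toPNat (c + ((k 0 : ℕ) - c)) (by omega) = k 0 :=
            PNat.eq (Nat.add_sub_cancel' h0)
          simp only [F, this]
    have h := (Equiv.ofBijective F hF).tsum_eq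
      (fun k => ENNReal.ofReal (multipleZetaTerm (a :: s) k.1))
    refine h.symm.trans ?_
    rw [ENNReal.tsum_sigma', iteratedZetaStar]
    refine tsum_congr fun i => ?_
    rw [← ih (by omega : 1 ≤ c + i), ← ENNReal.tsum_mul_left]
    refine tsum_congr fun t => ?_
    rw [← ENNReal.ofReal_mul (by positivity)]
    exact congrArg ENNReal.ofReal (multipleZetaTerm_cons a s _ t.1)

theorem tsum_multipleZetaTerm_eq_iteratedZetaStar (α : List ℕ) :
    ∑' k : ZetaStarIndex α.length, ENNReal.ofReal (multipleZetaTerm α k.1) =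
      iteratedZetaStar α 1 := by
  rw [← tsum_multipleZetaTerm α le_rfl]
  exact (Equiv.tsum_eq (Equiv.subtypeEquivRight fun k =>
    ⟨fun h => h.1, fun h => ⟨h, fun i => (k i).2⟩⟩)
    (fun k : ZetaStarIndex α.length => ENNReal.ofReal (multipleZetaTerm α k.1))).symm

theorem zetaStarSummable_of_ne_top {α : List ℕ} (h : iteratedZetaStar α 1 ≠ ∞) :
    ZetaStarSummable α := by
  rw [← tsum_multipleZetaTerm_eq_iteratedZetaStar] at h
  exact (ENNReal.summable_toReal h).congr fun k =>
    ENNReal.toReal_ofReal (multipleZetaTerm_nonneg _ _)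

theorem ofReal_multipleZetaStar {α : List ℕ} (h : iteratedZetaStar α 1 ≠ ∞) :
    ENNReal.ofReal (multipleZetaStar α) = iteratedZetaStar α 1 := by
  rw [← tsum_multipleZetaTerm_eq_iteratedZetaStar, multipleZetaStar,
    ENNReal.ofReal_tsum_of_nonneg (fun k => multipleZetaTerm_nonneg _ _)
      (zetaStarSummable_of_ne_top h)]

theorem ENNReal.tsum_tsum_add_eq (f : ℕ → ℕ → ℝ≥0∞) :
    ∑' (k : ℕ) (i : ℕ), f k (k + i) = ∑' l : ℕ, ∑ k ∈ range (l + 1), f k l := by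
  rw [← ENNReal.tsum_prod (f := fun k i => f k (k + i)),
    ← (HasAntidiagonal.sigmaAntidiagonalEquivProd (A := ℕ)).tsum_eq
      (fun p : ℕ × ℕ => f p.1 (p.1 + p.2)), ENNReal.tsum_sigma']
  refine tsum_congr fun l => ?_
  rw [← Finset.Nat.sum_antidiagonal_eq_sum_range_succ_mk (fun p : ℕ × ℕ => f p.1 l)]
  refine Eq.trans (tsum_congr fun p => ?_)
    (Finset.tsum_subtype (antidiagonal l) fun p : ℕ × ℕ => f p.1 l)
  simp only [HasAntidiagonal.sigmaAntidiagonalEquivProd_apply]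
  rw [mem_antidiagonal.1 p.2]

theorem iteratedZetaStar_replicate_one (m b c : ℕ) :
    iteratedZetaStar (List.replicate m 1 ++ [b]) c =
      ∑' i : ℕ, ENNReal.ofReal (multiHarmonic m c (c + i) * (((c + i : ℕ) : ℝ) ^ b)⁻¹) := by
  induction m generalizing c with
  | zero => simp [iteratedZetaStar, multiHarmonic]
  | succ m ih =>
    rw [List.replicate_succ, List.cons_append, iteratedZetaStar]
    simp only [ih, ← ENNReal.tsum_mul_left, add_assoc c]
    rw [ENNReal.tsum_tsum_add_eq (fun k l => ENNReal.ofReal (((c + k : ℕ) : ℝ) ^ 1)⁻¹ *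
      ENNReal.ofReal (multiHarmonic m (c + k) (c + l) * (((c + l : ℕ) : ℝ) ^ b)⁻¹))]
    refine tsum_congr fun l => ?_
    rw [multiHarmonic_succ_eq_sum_left, sum_mul, ENNReal.ofReal_sum_of_nonneg fun k _ =>
      mul_nonneg (div_nonneg (multiHarmonic_nonneg _ _ _) (Nat.cast_nonneg _)) (by positivity)]
    refine sum_congr rfl fun k _ => ?_
    rw [← ENNReal.ofReal_mul (by positivity), pow_one]
    congr 1
    ring

theorem iteratedZetaStar_height_two (m a b : ℕ) :
    iteratedZetaStar (a :: (List.replicate m 1 ++ [b])) 1 =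
      ∑' (k : ℕ) (i : ℕ), ENNReal.ofReal ((((k : ℝ) + 1) ^ a)⁻¹ *
        (multiHarmonic m (k + 1) (k + 1 + i) * (((k : ℝ) + 1 + i) ^ b)⁻¹)) := by
  rw [iteratedZetaStar]
  refine tsum_congr fun k => ?_
  rw [iteratedZetaStar_replicate_one, ← ENNReal.tsum_mul_left, add_comm 1 k]
  refine tsum_congr fun i => ?_
  rw [← ENNReal.ofReal_mul (by positivity)]
  push_cast
  rfl

/-! ### Summation over the outer variable -/

/-- Finiteness is what permits cancelling this series in `[0, ∞]`. The bound `harmonic q ≤ 2 √q`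
makes the terms `O(q^{-3/2})`. -/
theorem tsum_lowerSum_ne_top (m : ℕ) {N : ℕ} (hN : 1 ≤ N) :
    ∑' q : ℕ, ENNReal.ofReal ((((q : ℝ) + 1) ^ N)⁻¹ * lowerSum m q) ≠ ∞ := by
  have hH' : ∀ q : ℕ, (harmonic q : ℝ) ≤ 2 * √q := fun q => by
    induction q with
    | zero => simp
    | succ q ih =>
      rw [harmonic_succ]
      push_cast
      have e1 := Real.sq_sqrt (q.cast_nonneg : (0 : ℝ) ≤ q)
      have e2 := Real.sq_sqrt (by positivity : (0 : ℝ) ≤ (q : ℝ) + 1)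
      have h1 : 1 ≤ √((q : ℝ) + 1) := Real.one_le_sqrt.2 (by simp)
      set x := √(q : ℝ)
      set y := √((q : ℝ) + 1)
      have h2 : ((q : ℝ) + 1)⁻¹ ≤ 2 * y - 2 * x := by
        rw [← e2, inv_le_iff_one_le_mul₀ (by positivity)]
        -- Since `y² - x² = 1`, the right side equals `1 + (y - x)²`.
        have h3 : 1 ≤ (2 * y - 2 * x) * y := by nlinarith [sq_nonneg (y - x)]
        nlinarith
      linarith
  have hH : ∀ q : ℕ, (harmonic q : ℝ) ≤ 2 * √(q + 1) := fun q =>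
    (hH' q).trans (by gcongr; simp)
  have hs : Summable fun q : ℕ => ((m : ℝ) + 1) * 2 * (((q + 1 : ℕ) : ℝ) ^ (3 / 2 : ℝ))⁻¹ :=
    (((summable_nat_add_iff 1).2 (Real.summable_nat_rpow_inv.2 (by norm_num)))).mul_left _
  have hle : ∀ q : ℕ, (((q : ℝ) + 1) ^ N)⁻¹ * lowerSum m q ≤
      ((m : ℝ) + 1) * 2 * (((q + 1 : ℕ) : ℝ) ^ (3 / 2 : ℝ))⁻¹ := fun q => by
    have h1 : (1 : ℝ) ≤ (q : ℝ) + 1 := by linarith [(q.cast_nonneg : (0 : ℝ) ≤ q)]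
    have h0 : (0 : ℝ) < (q : ℝ) + 1 := by positivity
    have e : (((q + 1 : ℕ) : ℝ) ^ (3 / 2 : ℝ))⁻¹ = ((q : ℝ) + 1)⁻¹ * (√(q + 1) / (q + 1)) := by
      push_cast
      rw [Real.sqrt_eq_rpow, ← Real.rpow_neg h0.le, ← Real.rpow_sub_one h0.ne',
        ← Real.rpow_neg_one, ← Real.rpow_add h0]
      norm_num
    rw [e]
    calc (((q : ℝ) + 1) ^ N)⁻¹ * lowerSum m q
        ≤ ((q : ℝ) + 1)⁻¹ * (((m : ℝ) + 1) * ((2 * √(q + 1)) / (q + 1))) := by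
          refine mul_le_mul (inv_anti₀ h0 (le_self_pow₀ h1 (by omega)))
            ((lowerSum_le m q).trans ?_) (lowerSum_nonneg m q) (by positivity)
          gcongr
          exact hH q
      _ = _ := by ring
  have := (hs.of_nonneg_of_le
    (fun q => mul_nonneg (by positivity) (lowerSum_nonneg m q)) hle)
  rw [← ENNReal.ofReal_tsum_of_nonneg
    (fun q => mul_nonneg (by positivity) (lowerSum_nonneg m q)) this]
  exact ENNReal.ofReal_ne_top

theorem sum_inv_pow_mul_inv_pow {x y : ℝ} (hx : 0 < x) (hxy : x < y) (N : ℕ) :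
    ∑ j ∈ range N, (x ^ (j + 1))⁻¹ * (y ^ (N - j + 1))⁻¹ + (y ^ N)⁻¹ / (y * (y - x)) =
      (x ^ N)⁻¹ / (y * (y - x)) := by
  have hy := hx.trans hxy
  have h0 : y - x ≠ 0 := (sub_pos.2 hxy).ne'
  have h := (Commute.all x⁻¹ y⁻¹).geom_sum₂_mul N
  have e : ∑ j ∈ range N, (x ^ (j + 1))⁻¹ * (y ^ (N - j + 1))⁻¹ =
      x⁻¹ * y⁻¹ ^ 2 * ∑ j ∈ range N, x⁻¹ ^ j * y⁻¹ ^ (N - 1 - j) := by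
    rw [mul_sum]
    refine sum_congr rfl fun j hj => ?_
    have hj := mem_range.1 hj
    rw [show N - j + 1 = (N - 1 - j) + 2 by omega, ← inv_pow, ← inv_pow]
    ring
  have hsub : x⁻¹ - y⁻¹ = (y - x) / (x * y) := by field_simp
  rw [hsub, ← eq_div_iff (by positivity)] at h
  rw [e, h]
  simp only [inv_pow]
  field_simp
  ring

theorem sum_filter_antidiagonal_succ {M : Type*} [AddCommMonoid M] (N : ℕ) (f : ℕ × ℕ → M) :
    ∑ α ∈ (HasAntidiagonal.antidiagonal (N + 1)).filter (fun α => 1 ≤ α.1 ∧ 1 ≤ α.2), f α =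
      ∑ j ∈ range N, f (j + 1, N - j) := by
  refine sum_nbij' (fun α => α.1 - 1) (fun j => (j + 1, N - j)) ?_ ?_ ?_ ?_ ?_
  · rintro ⟨a, b⟩ h
    simp only [mem_filter, HasAntidiagonal.mem_antidiagonal] at h
    simp only [mem_range]
    omega
  · intro j h
    have := mem_range.1 h
    simp only [mem_filter, HasAntidiagonal.mem_antidiagonal]
    omega
  · rintro ⟨a, b⟩ h
    simp only [mem_filter, HasAntidiagonal.mem_antidiagonal] at h
    ext <;> simp only <;> omega
  · intro j _
    simp
  · rintro ⟨a, b⟩ h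
    simp only [mem_filter, HasAntidiagonal.mem_antidiagonal] at h
    congr 2
    · omega
    · simp only
      omega

theorem tsum_upperSum (m N : ℕ) :
    ∑' (k : ℕ) (i : ℕ), ENNReal.ofReal ((((k : ℝ) + 1) ^ N)⁻¹ *
        (multiHarmonic m (k + 1) (k + i + 2) / (((k : ℝ) + i + 2) * (i + 1)))) =
      ∑' q : ℕ, ENNReal.ofReal ((((q : ℝ) + 1) ^ N)⁻¹ * lowerSum m q) +
        ∑' q : ℕ, ENNReal.ofReal (((m : ℝ) + 1) * (((q : ℝ) + 1) ^ (m + N + 2))⁻¹) := by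
  rw [← ENNReal.tsum_add]
  refine tsum_congr fun k => ?_
  have h := (hasSum_upperSum m k).mul_left (((k : ℝ) + 1) ^ N)⁻¹
  rw [← ENNReal.ofReal_tsum_of_nonneg (fun i => mul_nonneg (by positivity)
    (div_nonneg (multiHarmonic_nonneg _ _ _) (by positivity))) h.summable, h.tsum_eq,
    ← ENNReal.ofReal_add (mul_nonneg (by positivity) (lowerSum_nonneg m k)) (by positivity)]
  congr 1
  rw [show m + N + 2 = N + (m + 2) by ring, pow_add _ N, mul_inv]
  ring

theorem tsum_lowerSum (m N : ℕ) :
    ∑' (k : ℕ) (i : ℕ), ENNReal.ofReal ((((k : ℝ) + i + 2) ^ N)⁻¹ *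
        (multiHarmonic m (k + 1) (k + i + 2) / (((k : ℝ) + i + 2) * (i + 1)))) =
      ∑' q : ℕ, ENNReal.ofReal ((((q : ℝ) + 1) ^ N)⁻¹ * lowerSum m q) := by
  have h := ENNReal.tsum_tsum_add_eq (fun k l => ENNReal.ofReal ((((l : ℝ) + 2) ^ N)⁻¹ *
    (multiHarmonic m (k + 1) (l + 2) / (((l : ℝ) + 2) * (l - k + 1)))))
  have hz : ∀ g : ℕ → ℝ≥0∞, ∑' q, g q = g 0 + ∑' q, g (q + 1) := fun g =>
    tsum_eq_zero_add' ENNReal.summable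
  -- The `q = 0` term is an empty sum; removing it matches `q = l + 1` with the larger variable `l +
  -- 2`.
  rw [hz fun q => ENNReal.ofReal ((((q : ℝ) + 1) ^ N)⁻¹ * lowerSum m q)]
  simp only [lowerSum, range_zero, sum_empty, mul_zero, ENNReal.ofReal_zero, zero_add]
  refine Eq.trans ?_ (h.trans ?_)
  · refine tsum_congr fun k => tsum_congr fun i => ?_
    push_cast
    rw [show (k : ℝ) + i - k + 1 = i + 1 by ring]
  · refine tsum_congr fun l => ?_
    rw [mul_sum, ENNReal.ofReal_sum_of_nonneg]
    · refine sum_congr rfl fun k _ => ?_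
      push_cast
      rw [show (l : ℝ) + 1 + 1 = l + 2 by ring, show (l : ℝ) + 1 - k = l - k + 1 by ring]
    · intro k hk
      have : (k : ℝ) ≤ ((l + 1 : ℕ) : ℝ) := by exact_mod_cast (mem_range.1 hk).le
      have := sub_nonneg.2 this
      exact mul_nonneg (by positivity) (div_nonneg (multiHarmonic_nonneg _ _ _) (by positivity))

theorem sum_iteratedZetaStar (m : ℕ) {N : ℕ} (hN : 1 ≤ N) :
    ∑ j ∈ range N, iteratedZetaStar ((j + 1) :: (List.replicate m 1 ++ [N - j + 1])) 1 =
      ∑' q : ℕ, ENNReal.ofReal (((m : ℝ) + N + 1) * (((q : ℝ) + 1) ^ (m + N + 2))⁻¹) := by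
  have hfin := tsum_lowerSum_ne_top m hN
  -- The negative part of the geometric sum is moved to the other side, as subtraction in `[0, ∞]`
  -- is truncated.
  refine (ENNReal.add_left_inj hfin).1 ?_
  conv_lhs => rw [← tsum_lowerSum]
  have hdiag : ∑' q : ℕ, ENNReal.ofReal (((m : ℝ) + N + 1) * (((q : ℝ) + 1) ^ (m + N + 2))⁻¹) =
      ∑' q : ℕ, ENNReal.ofReal ((N : ℝ) * (((q : ℝ) + 1) ^ (m + N + 2))⁻¹) +
      ∑' q : ℕ, ENNReal.ofReal (((m : ℝ) + 1) * (((q : ℝ) + 1) ^ (m + N + 2))⁻¹) := by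
    rw [← ENNReal.tsum_add]
    refine tsum_congr fun q => ?_
    rw [← ENNReal.ofReal_add (by positivity) (by positivity)]
    congr 1
    ring
  rw [hdiag, add_assoc, add_comm (∑' q : ℕ, ENNReal.ofReal (((m : ℝ) + 1) * _)),
    ← tsum_upperSum, ← ENNReal.tsum_add]
  simp only [iteratedZetaStar_height_two]
  rw [← Summable.tsum_finsetSum fun _ _ => ENNReal.summable, ← ENNReal.tsum_add]
  refine tsum_congr fun k => ?_
  -- The diagonal `i = 0` is separated, because the geometric sum formula requires distinct outer
  -- variables.
  rw [← Summable.tsum_finsetSum fun _ _ => ENNReal.summable,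
    tsum_eq_zero_add' ENNReal.summable, add_assoc, ← ENNReal.tsum_add]
  have hnn : ∀ i j : ℕ, 0 ≤ (((k : ℝ) + 1) ^ (j + 1))⁻¹ *
      (multiHarmonic m (k + 1) (k + 1 + i) * (((k : ℝ) + 1 + i) ^ (N - j + 1))⁻¹) := fun i j =>
    mul_nonneg (by positivity) (mul_nonneg (multiHarmonic_nonneg _ _ _) (by positivity))
  congr 1
  · rw [← ENNReal.ofReal_sum_of_nonneg fun j _ => hnn 0 j]
    congr 1
    rw [add_zero, multiHarmonic_self]
    have : ∀ j ∈ range N, (((k : ℝ) + 1) ^ (j + 1))⁻¹ * ((((k + 1 : ℕ) : ℝ) ^ m)⁻¹ *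
        (((k : ℝ) + 1 + (0 : ℕ)) ^ (N - j + 1))⁻¹) = (((k : ℝ) + 1) ^ (m + N + 2))⁻¹ :=
      fun j hj => by
        have := mem_range.1 hj
        rw [show m + N + 2 = (j + 1) + (m + (N - j + 1)) by omega, pow_add _ (j + 1), pow_add _ m]
        push_cast
        rw [mul_inv, mul_inv, add_zero]
    rw [sum_congr rfl this, sum_const, card_range, nsmul_eq_mul]
  · refine tsum_congr fun i => ?_
    have h1 : ∀ x : ℝ, 0 ≤ x → 0 ≤ x * (multiHarmonic m (k + 1) (k + i + 2) /
        (((k : ℝ) + i + 2) * (i + 1))) := fun x hx =>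
      mul_nonneg hx (div_nonneg (multiHarmonic_nonneg _ _ _) (by positivity))
    rw [← ENNReal.ofReal_sum_of_nonneg fun j _ => hnn (i + 1) j,
      ← ENNReal.ofReal_add (sum_nonneg fun j _ => hnn (i + 1) j) (h1 _ (by positivity))]
    congr 1
    have h := congrArg (multiHarmonic m (k + 1) (k + i + 2) * ·)
      (sum_inv_pow_mul_inv_pow (x := (k : ℝ) + 1) (y := (k : ℝ) + i + 2) (by positivity)
        (by linarith [(i.cast_nonneg : (0 : ℝ) ≤ i)]) N)
    simp only [mul_add, mul_sum] at h
    rw [show (k : ℝ) + i + 2 - (k + 1) = i + 1 by ring] at h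
    rw [show k + 1 + (i + 1) = k + i + 2 by ring]
    push_cast
    rw [show (k : ℝ) + 1 + (i + 1) = k + i + 2 by ring]
    refine Eq.trans (congrArg₂ (· + ·) (sum_congr rfl fun j _ => ?_) ?_) (h.trans ?_) <;> ring

/-! ### Return to real values and the Riemann zeta function -/

theorem summable_inv_succ_pow {s : ℕ} (hs : 2 ≤ s) :
    Summable fun q : ℕ => (((q : ℝ) + 1) ^ s)⁻¹ := by
  simpa using (summable_nat_add_iff 1).2 (Real.summable_nat_pow_inv.2 hs)

theorem riemannZeta_natCast_eq_tsum_succ {s : ℕ} (hs : 2 ≤ s) :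
    riemannZeta s = ((∑' q : ℕ, (((q : ℝ) + 1) ^ s)⁻¹ : ℝ) : ℂ) := by
  rw [zeta_eq_tsum_one_div_nat_add_one_cpow (by simpa using! hs), Complex.ofReal_tsum]
  refine tsum_congr fun q => ?_
  simp

theorem theorem1p1 (m n : ℕ) (hn : 2 ≤ n) :
    (∀ α₁ α₂ : ℕ, 1 ≤ α₁ → 1 ≤ α₂ → α₁ + α₂ = n →
      ZetaStarSummable (α₁ :: (List.replicate m 1 ++ [α₂ + 1]))) ∧
    ((∑ α ∈ (Finset.HasAntidiagonal.antidiagonal n).filter (fun α => 1 ≤ α.1 ∧ 1 ≤ α.2),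
        multipleZetaStar (α.1 :: (List.replicate m 1 ++ [α.2 + 1])) : ℝ) : ℂ)
      = ((m : ℂ) + (n : ℂ)) * riemannZeta ((m : ℂ) + (n : ℂ) + 1) := by
  obtain ⟨N, rfl⟩ : ∃ N, n = N + 1 := ⟨n - 1, by omega⟩
  have hN : 1 ≤ N := by omega
  have hs := (summable_inv_succ_pow (by omega : 2 ≤ m + N + 2)).mul_left ((m : ℝ) + N + 1)
  have hsum := sum_iteratedZetaStar m hN
  rw [← ENNReal.ofReal_tsum_of_nonneg (fun q => by positivity) hs] at hsum
  have hfin : ∀ j ∈ range N,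
      iteratedZetaStar ((j + 1) :: (List.replicate m 1 ++ [N - j + 1])) 1 ≠ ∞ :=
    -- Convergence of every star series follows from the identity itself: a finite total in `[0, ∞]`
    -- has finite summands.
    ENNReal.sum_ne_top.1 (hsum ▸ ENNReal.ofReal_ne_top)
  have hnn : ∀ α : List ℕ, 0 ≤ multipleZetaStar α := fun α =>
    tsum_nonneg fun k => multipleZetaTerm_nonneg _ _
  refine ⟨fun a b ha hb hab => ?_, ?_⟩
  · have := hfin (a - 1) (mem_range.2 (by omega))
    rw [show a - 1 + 1 = a by omega, show N - (a - 1) = b by omega] at this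
    exact zetaStarSummable_of_ne_top this
  · rw [sum_congr rfl fun j hj => (ofReal_multipleZetaStar (hfin j hj)).symm,
      ← ENNReal.ofReal_sum_of_nonneg fun j _ => hnn _,
      ENNReal.ofReal_eq_ofReal_iff (sum_nonneg fun j _ => hnn _)
        (tsum_nonneg fun q => by positivity), tsum_mul_left] at hsum
    rw [sum_filter_antidiagonal_succ, hsum,
      show (m : ℂ) + ((N + 1 : ℕ) : ℂ) + 1 = ((m + N + 2 : ℕ) : ℂ) by push_cast; ring,
      riemannZeta_natCast_eq_tsum_succ (by omega)]
    push_cast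
    ring
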